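/- For $d\ge 0$ identify $\mathbb{Z}^d$ with the integer points of $\mathbb{R}^d$. A convex polytope is the convex hull of a finite set; it is *integral* if all its vertices have integer coordinates, and a *$(0,1)$-polytope* if all its vertices lie in $\{0,1\}^d$. An integral convex polytope $\mathcal{P}\subset\mathbb{R}^d$ possesses the *integer decomposition property* if for every integer $n\ge 1$ and every $\gamma\in n\mathcal{P}\cap\mathbb{Z}^d$, where $n\mathcal{P}=\{n\alpha:\alpha\in\mathcal{P}\}$, there exist $\gamma^{(1)},\dots,\gamma^{(n)}\in\mathcal{P}\cap\mathbb{Z}^d$ with $\gamma=\gamma^{(1)}+\cdots+\gamma^{(n)}$. If $\mathcal{P}\subset\mathbb{R}^d$ and $\mathcal{Q}\subset\mathbb{R}^e$ are convex polytopes containing the origins, their *free sum* $\mathcal{P}\oplus\mathcal{Q}\subset\mathbb{R}^{d+e}$ is the convex hull of $\{(\alpha,\mathbf{0}_e):\alpha\in\mathcal{P}\}\cup\{(\mathbf{0}_d,\beta):\beta\in\mathcal{Q}\}$. Let $\mathcal{P}\subset\mathbb{R}^d$ be a $(0,1)$-polytope of dimension $d$ containing the origin $\mathbf{0}_d$, and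 let $\mathcal{Q}\subset\mathbb{R}^e$ be an integral convex polytope of dimension $e$ containing the origin $\mathbf{0}_e$. Suppose that $\mathcal{P}\cap\mathbb{Z}^d$ generates the group $\mathbb{Z}^d$ and that $\mathcal{Q}\cap\mathbb{Z}^e$ generates the group $\mathbb{Z}^e$. Then $\mathcal{P}\oplus\mathcal{Q}$ possesses the integer decomposition property if and only if the following two conditions are satisfied: - each of $\mathcal{P}$ and $\mathcal{Q}$ possesses the integer decomposition property; - at least one of $\mathcal{P}$ and $\mathcal{Q}$ has the property that, for each of its facets, the hyperplane spanned by the facet has an equation of the form $\sum_{i=1}^{f}a_iz_i=b$ with all $a_i\in\mathbb{Z}$ and $b\in\{0,1\}$, where $f=d$ for $\mathcal{P}$ and $f=e$ for $\mathcal{Q}$. -/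

import Mathlib

namespace LatticePolytope

/-- The integer lattice `ℤ^ι`, viewed as a subset of `ℝ^ι`. -/
def integerPoints (ι : Type*) : Set (ι → ℝ) :=
  {x | ∀ i, ∃ z : ℤ, x i = (z : ℝ)}

/-- A convex polytope: the convex hull of a finite set of points. -/
def IsPolytope {ι : Type*} (P : Set (ι → ℝ)) : Prop :=
  ∃ S : Set (ι → ℝ), S.Finite ∧ P = convexHull ℝ S

/-- An integral convex polytope: every vertex (extreme point) has integer coordinates. -/
def IsIntegralPolytope {ι : Type*} (P : Set (ι → ℝ)) : Prop :=
  IsPolytope P ∧ P.extremePoints ℝ ⊆ integerPoints ι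

/-- A `(0,1)`-polytope: every vertex (extreme point) belongs to `{0,1}^ι`. -/
def IsZeroOnePolytope {ι : Type*} (P : Set (ι → ℝ)) : Prop :=
  IsPolytope P ∧ ∀ v ∈ P.extremePoints ℝ, ∀ i, v i = 0 ∨ v i = 1

/-- The dimension of (the affine hull of) a nonempty subset of `ℝ^ι`. -/
noncomputable def dim {ι : Type*} (P : Set (ι → ℝ)) : ℕ :=
  Module.finrank ℝ (vectorSpan ℝ P)

/-- The lattice points of `P` generate the group `ℤ^ι`. -/
def SpansLattice {ι : Type*} (P : Set (ι → ℝ)) : Prop :=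
  (AddSubgroup.closure (P ∩ integerPoints ι) : Set (ι → ℝ)) = integerPoints ι

/-- The integer decomposition property: for every `n ≥ 1`, each lattice point of `nP` is a sum
of `n` lattice points of `P`. -/
def HasIDP {ι : Type*} (P : Set (ι → ℝ)) : Prop :=
  ∀ n : ℕ, 1 ≤ n → ∀ γ ∈ ((fun α : ι → ℝ => (n : ℝ) • α) '' P) ∩ integerPoints ι,
    ∃ g : Fin n → (ι → ℝ), (∀ j, g j ∈ P ∩ integerPoints ι) ∧ γ = ∑ j, g j

/-- `F` is a facet of `P`: a nonempty face of `P`, cut out by a supporting hyperplane, whose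
dimension is one less than the dimension of `P`. -/
def IsFacet {ι : Type*} (P F : Set (ι → ℝ)) : Prop :=
  IsExposed ℝ P F ∧ F.Nonempty ∧ dim F + 1 = dim P

/-- The equation of each facet of `P` (that is, of the hyperplane that the facet spans) is of the
form `∑ i, a i * z i = b` with integers `a i` and `b ∈ {0, 1}`. -/
def HasZeroOneFacetEquations {ι : Type*} [Fintype ι] (P : Set (ι → ℝ)) : Prop :=
  ∀ F : Set (ι → ℝ), IsFacet P F →
    ∃ (a : ι → ℤ) (b : ℤ), (b = 0 ∨ b = 1) ∧
      (affineSpan ℝ F : Set (ι → ℝ)) = {z | ∑ i, (a i : ℝ) * z i = (b : ℝ)}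

/-- The canonical injection `α ↦ (α, 0)` of `ℝ^d` into `ℝ^(d+e)`. -/
def inlMap (d e : ℕ) (α : Fin d → ℝ) : Fin (d + e) → ℝ :=
  Fin.append α (0 : Fin e → ℝ)

/-- The canonical injection `β ↦ (0, β)` of `ℝ^e` into `ℝ^(d+e)`. -/
def inrMap (d e : ℕ) (β : Fin e → ℝ) : Fin (d + e) → ℝ :=
  Fin.append (0 : Fin d → ℝ) β

/-- The free sum `P ⊕ Q`: the convex hull in `ℝ^(d+e)` of the two embedded polytopes. -/
def freeSum {d e : ℕ} (P : Set (Fin d → ℝ)) (Q : Set (Fin e → ℝ)) : Set (Fin (d + e) → ℝ) :=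
  convexHull ℝ (inlMap d e '' P ∪ inrMap d e '' Q)

end LatticePolytope

/-! Because `P` lies in the unit cube, a lattice point of the free sum lies in one of the two
summands (`lattice_point_freeSum`). Hence the free sum has the integer decomposition property
exactly when `P` and `Q` have it and every lattice point `(x, y)` of the `n`-fold dilate admits
natural numbers `k + m = n` with `x ∈ kP`, `y ∈ mQ`. A split `r + s = n` into nonnegative reals
always exists, so the question is when it can be made integral.

If the facets of one summand, say `P`, have right-hand sides `0` or `1`, the functionals of the
facets off the origin are integral on lattice points. Then `x ∈ rP` forces `x ∈ ⌊r⌋P`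
(`mem_floor_smul_set`), and `y` fits into the remaining `n - ⌊r⌋ ≥ s`.

Conversely, if a summand has a bad facet, some lattice point lies in its `(m + 1/2)`-dilate but not
in its `m`-dilate (the contrapositive of `hasZeroOneFacetEquations_of_round`). When both summands
do, pairing two such points gives a lattice point of the `(m + m' + 1)`-fold dilate with no integral
split. -/

open scoped Pointwise

namespace LatticePolytope

/-! ### Dilates of convex sets containing the origin -/

section Dilates

variable {E : Type*} [AddCommGroup E] [Module ℝ E] {P : Set E}

/-- By convexity `sP = rP + (s - r)P`, and the second summand contains the origin. -/
theorem smul_set_mono (hP : Convex ℝ P) (h0 : (0 : E) ∈ P) {r s : ℝ} (hr : 0 ≤ r) (hrs : r ≤ s) :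
    r • P ⊆ s • P := by
  have h := hP.add_smul hr (sub_nonneg.2 hrs)
  rw [add_sub_cancel] at h
  rw [h]
  intro x hx
  exact ⟨x, hx, 0, ⟨0, h0, smul_zero _⟩, add_zero x⟩

theorem sum_smul_mem_smul_set (hP : Convex ℝ P) (h0 : (0 : E) ∈ P) {κ : Type*} (s : Finset κ)
    (w : κ → ℝ) (v : κ → E) (hw : ∀ i ∈ s, 0 ≤ w i) (hv : ∀ i ∈ s, v i ∈ P) :
    ∑ i ∈ s, w i • v i ∈ (∑ i ∈ s, w i) • P := by
  classical
  induction s using Finset.induction_on with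
  | empty => exact ⟨0, h0, by simp⟩
  | insert a s ha ih =>
    have hs : ∀ i ∈ s, 0 ≤ w i := fun i hi => hw i (Finset.mem_insert_of_mem hi)
    rw [Finset.sum_insert ha, Finset.sum_insert ha,
      hP.add_smul (hw a (Finset.mem_insert_self a s)) (Finset.sum_nonneg hs)]
    exact Set.add_mem_add (Set.smul_mem_smul_set (hv a (Finset.mem_insert_self a s)))
      (ih hs fun i hi => hv i (Finset.mem_insert_of_mem hi))

theorem sum_mem_card_smul_set (hP : Convex ℝ P) (h0 : (0 : E) ∈ P) {κ : Type*} (s : Finset κ)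
    (v : κ → E) (hv : ∀ i ∈ s, v i ∈ P) : ∑ i ∈ s, v i ∈ (s.card : ℝ) • P := by
  simpa using sum_smul_mem_smul_set hP h0 s (fun _ => 1) v (fun _ _ => zero_le_one) hv

theorem le_of_mem_smul_set {f : Module.Dual ℝ E} {c r : ℝ} (hf : ∀ v ∈ P, f v ≤ c) (hr : 0 ≤ r)
    {x : E} (hx : x ∈ r • P) : f x ≤ r * c := by
  obtain ⟨p, hp, rfl⟩ := hx
  simpa using mul_le_mul_of_nonneg_left (hf p hp) hr

theorem le_on_convexHull {S : Set E} {f : Module.Dual ℝ E} {c : ℝ} (hf : ∀ v ∈ S, f v ≤ c) :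
    ∀ v ∈ convexHull ℝ S, f v ≤ c := fun _ hv =>
  convexHull_min (t := {v | f v ≤ c}) hf (convex_halfSpace_le f.isLinear c) hv

end Dilates

/-! ### Supporting functionals with many tight generators -/

section Functionals

variable {E : Type*} [AddCommGroup E] [Module ℝ E]

/-- Points where a maximum over a convex hull is attained see only the tight generators. -/
theorem eq_zero_of_eq_zero_on_tight {S : Set E} (hS : S.Finite) {l m : Module.Dual ℝ E} {z : E}
    (hl : ∀ v ∈ S, l v ≤ 1) (hz : z ∈ convexHull ℝ S) (hlz : l z = 1)
    (hm : ∀ v ∈ S, l v = 1 → m v = 0) : m z = 0 := by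
  lift S to Finset E using hS
  obtain ⟨w, hw, hw1, rfl⟩ := Finset.mem_convexHull'.1 hz
  simp only [map_sum, map_smul, smul_eq_mul] at hlz ⊢
  have h0 : ∑ v ∈ S, w v * (1 - l v) = 0 := by
    simp only [mul_sub, mul_one, Finset.sum_sub_distrib, hw1, hlz, sub_self]
  rw [Finset.sum_eq_zero_iff_of_nonneg
    fun v hv => mul_nonneg (hw v hv) (sub_nonneg.2 (hl v hv))] at h0
  refine Finset.sum_eq_zero fun v hv => ?_
  rcases mul_eq_zero.1 (h0 v hv) with h | h
  · rw [h, zero_mul]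
  · rw [hm v hv (by linarith), mul_zero]

/-- A functional bounded by `1` on a finite spanning set and equal to `1` at a point of its convex
hull can be chosen with a spanning set of tight generators. -/
theorem exists_dual_span_tight_eq_top {S : Set E} (hS : S.Finite)
    (hspan : Submodule.span ℝ S = ⊤) {z : E} (hz : z ∈ convexHull ℝ S)
    {l : Module.Dual ℝ E} (hl : ∀ v ∈ S, l v ≤ 1) (hlz : l z = 1) :
    ∃ l' : Module.Dual ℝ E, (∀ v ∈ S, l' v ≤ 1) ∧ l' z = 1 ∧
      Submodule.span ℝ {v ∈ S | l' v = 1} = ⊤ := by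
  let 𝒯 : Set (Set E) := {T | ∃ l' : Module.Dual ℝ E, (∀ v ∈ S, l' v ≤ 1) ∧ l' z = 1 ∧
    T = {v ∈ S | l' v = 1}}
  have hfin : 𝒯.Finite := hS.finite_subsets.subset (by
    rintro _ ⟨l', -, -, rfl⟩
    exact Set.sep_subset _ _)
  -- Take `k` with an inclusion-maximal tight set. If that set did not span, some nonzero `m` would
  -- vanish on it.
  obtain ⟨T, ⟨k, hk, hkz, rfl⟩, hmax⟩ := hfin.exists_maximal ⟨_, l, hl, hlz, rfl⟩
  refine ⟨k, hk, hkz, ?_⟩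
  by_contra hne
  obtain ⟨m, hm0, hm⟩ := Submodule.exists_le_ker_of_lt_top _ (lt_top_iff_ne_top.2 hne)
  -- Tilt `k` in the direction `m` until a new generator becomes tight. The value at `z` does not
  -- change, since `m z = 0`, so maximality is violated.
  have key : ∀ m : Module.Dual ℝ E, (∀ v ∈ S, k v = 1 → m v = 0) → (∃ v ∈ S, 0 < m v) → False := by
    intro m hm hpos
    obtain ⟨v₀, ⟨hv₀, hmv₀⟩, hmin⟩ := Set.exists_min_image {v ∈ S | 0 < m v}
      (fun v => (1 - k v) / m v) (hS.subset (Set.sep_subset _ _)) hpos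
    set t := (1 - k v₀) / m v₀ with ht
    have ht0 : 0 ≤ t := div_nonneg (sub_nonneg.2 (hk v₀ hv₀)) hmv₀.le
    have hmz : m z = 0 := eq_zero_of_eq_zero_on_tight hS hk hz hkz hm
    have hle : ∀ v ∈ S, (k + t • m) v ≤ 1 := by
      intro v hv
      simp only [LinearMap.add_apply, LinearMap.smul_apply, smul_eq_mul]
      rcases le_or_gt (m v) 0 with h | h
      · nlinarith [hk v hv, mul_nonneg ht0 (neg_nonneg.2 h)]
      · have := (le_div_iff₀ h).1 (hmin v ⟨hv, h⟩)
        linarith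
    have hsub := hmax ⟨k + t • m, hle, by simp [hkz, hmz], rfl⟩ (by
      rintro v ⟨hv, hkv⟩
      exact ⟨hv, by simp [hkv, hm v hv hkv]⟩)
    have hmem : v₀ ∈ {v ∈ S | (k + t • m) v = 1} := by
      refine ⟨hv₀, ?_⟩
      simp only [LinearMap.add_apply, LinearMap.smul_apply, smul_eq_mul]
      rw [ht, div_mul_cancel₀ _ hmv₀.ne']
      ring
    exact hmv₀.ne' (hm v₀ hv₀ (hsub hmem).2)
  have hm' : ∀ v ∈ S, k v = 1 → m v = 0 := fun v hv h => hm (Submodule.subset_span ⟨hv, h⟩)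
  obtain ⟨v, hv, hmv⟩ : ∃ v ∈ S, m v ≠ 0 := by
    by_contra! h
    refine hm0 (LinearMap.ker_eq_top.1 (top_le_iff.1 ?_))
    rw [← hspan, Submodule.span_le]
    exact h
  rcases hmv.lt_or_gt with h | h
  · exact key (-m) (fun v hv hv1 => by simp [hm' v hv hv1]) ⟨v, hv, by simpa using h⟩
  · exact key m hm' ⟨v, hv, h⟩

end Functionals

/-! ### Facets and their hyperplanes -/

section Hyperplanes

variable {ι : Type*} [Fintype ι]

theorem exists_dual_eq_sum_mul (a : ι → ℝ) : ∃ f : Module.Dual ℝ (ι → ℝ), ∀ x, f x = ∑ i, a i * x i :=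
  ⟨∑ i, a i • LinearMap.proj i, fun x => by simp⟩

theorem affineSpan_eq_of_dim_add_one {F : Set (ι → ℝ)} (hne : F.Nonempty)
    (hdim : dim F + 1 = Fintype.card ι) {f : Module.Dual ℝ (ι → ℝ)} (hf : f ≠ 0) {c : ℝ}
    (hF : ∀ v ∈ F, f v = c) : (affineSpan ℝ F : Set (ι → ℝ)) = {z | f z = c} := by
  have hle : vectorSpan ℝ F ≤ LinearMap.ker f := by
    rw [vectorSpan_def, Submodule.span_le]
    rintro _ ⟨x, hx, y, hy, rfl⟩
    simp [hF x hx, hF y hy]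
  have heq : vectorSpan ℝ F = LinearMap.ker f := by
    refine Submodule.eq_of_le_of_finrank_le hle ?_
    have := Module.Dual.finrank_ker_add_one_of_ne_zero hf
    rw [Module.finrank_fintype_fun_eq_card] at this
    unfold dim at hdim
    omega
  obtain ⟨v, hv⟩ := hne
  ext z
  have hz := AffineSubspace.vsub_right_mem_direction_iff_mem (mem_affineSpan ℝ hv) z
  rw [SetLike.mem_coe, ← hz, direction_affineSpan, heq, LinearMap.mem_ker]
  simp [hF v hv, sub_eq_zero]

theorem affineSpan_eq_top_of_dim {P : Set (ι → ℝ)} (hne : P.Nonempty)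
    (hdim : dim P = Fintype.card ι) : affineSpan ℝ P = ⊤ := by
  rw [AffineSubspace.affineSpan_eq_top_iff_vectorSpan_eq_top_of_nonempty ℝ _ _ hne]
  apply Submodule.eq_top_of_finrank_eq
  rw [Module.finrank_fintype_fun_eq_card]
  exact hdim

theorem span_eq_top_of_dim_convexHull {S : Set (ι → ℝ)} (hne : (convexHull ℝ S).Nonempty)
    (hdim : dim (convexHull ℝ S) = Fintype.card ι) : Submodule.span ℝ S = ⊤ := by
  have h := affineSpan_eq_top_of_dim hne hdim
  rw [affineSpan_convexHull] at h
  have h2 := affineSpan_subset_span (k := ℝ) (s := S)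
  rw [h] at h2
  exact top_le_iff.1 fun x _ => h2 (Set.mem_univ x)

/-- A functional with a spanning set of tight points cuts out a facet. -/
theorem isFacet_of_span_tight_eq_top {P T : Set (ι → ℝ)} (hdim : dim P = Fintype.card ι)
    {f : Module.Dual ℝ (ι → ℝ)} (hf : ∀ v ∈ P, f v ≤ 1) {z : ι → ℝ} (hz : z ∈ P) (hfz : f z = 1)
    (hTP : T ⊆ P) (hT : ∀ v ∈ T, f v = 1) (hspan : Submodule.span ℝ T = ⊤) :
    IsFacet P {x ∈ P | f x = 1} := by
  have hf0 : f ≠ 0 := by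
    rintro rfl
    simp at hfz
  refine ⟨fun _ => ⟨LinearMap.toContinuousLinearMap f, ?_⟩, ⟨z, hz, hfz⟩, ?_⟩
  · ext x
    refine and_congr_right fun hx => ⟨fun h y hy => ?_, fun h => ?_⟩
    · simpa [h] using hf y hy
    · exact le_antisymm (hf x hx) (by simpa [hfz] using h z hz)
  · have hker := Module.Dual.finrank_ker_add_one_of_ne_zero hf0
    rw [Module.finrank_fintype_fun_eq_card] at hker
    suffices h : vectorSpan ℝ {x ∈ P | f x = 1} = LinearMap.ker f by rw [hdim, ← hker, dim, h]
    apply le_antisymm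
    · rw [vectorSpan_def, Submodule.span_le]
      rintro _ ⟨x, hx, y, hy, rfl⟩
      simp [hx.2, hy.2]
    · set F := {x ∈ P | f x = 1}
      -- The projection along `z` onto `ker f` sends each tight point to a difference of two points
      -- of `F`. It fixes `ker f`, and the tight points span.
      have htop : ∀ x, x - f x • z ∈ vectorSpan ℝ F := by
        intro x
        have hx : x ∈ Submodule.span ℝ T := hspan ▸ Submodule.mem_top
        induction hx using Submodule.span_induction with
        | mem v hv =>
          rw [hT v hv, one_smul]
          exact vsub_mem_vectorSpan ℝ (show v ∈ F from ⟨hTP hv, hT v hv⟩) ⟨hz, hfz⟩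
        | zero => simp
        | add x y _ _ hx hy =>
          have : x + y - f (x + y) • z = (x - f x • z) + (y - f y • z) := by
            rw [map_add, add_smul]
            abel
          rw [this]
          exact add_mem hx hy
        | smul c x _ hx =>
          have : c • x - f (c • x) • z = c • (x - f x • z) := by
            rw [map_smul, smul_sub, smul_assoc]
          rw [this]
          exact Submodule.smul_mem _ c hx
      intro x hx
      have := htop x
      rwa [LinearMap.mem_ker.1 hx, zero_smul, sub_zero] at this

/-- The functional of a facet off the origin takes integer values on lattice points as soon as the
facets have equations with right-hand side `0` or `1`. -/
theorem exists_int_eq_of_hasZeroOneFacetEquations {P : Set (ι → ℝ)}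
    (hP : HasZeroOneFacetEquations P) (hdim : dim P = Fintype.card ι)
    {f : Module.Dual ℝ (ι → ℝ)} (hf : f ≠ 0) (hF : IsFacet P {x ∈ P | f x = 1})
    {x : ι → ℝ} (hx : x ∈ integerPoints ι) : ∃ k : ℤ, f x = k := by
  obtain ⟨a, b, hb, hab⟩ := hP _ hF
  obtain ⟨g, hg⟩ := exists_dual_eq_sum_mul fun i => (a i : ℝ)
  have haff := affineSpan_eq_of_dim_add_one hF.2.1 (hF.2.2.trans hdim) hf (c := 1) fun v hv => hv.2
  rw [haff] at hab
  have hfg : ∀ z, f z = 1 ↔ g z = b := fun z => by rw [hg]; exact Set.ext_iff.1 hab z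
  -- The hyperplane `f = 1` misses the origin, which rules out `b = 0`.
  have hb1 : b = 1 := by
    rcases hb with rfl | h
    · have := (hfg 0).2 (by simp)
      simp at this
    · exact h
  subst hb1
  choose k hk using hx
  refine ⟨∑ i, a i * k i, ?_⟩
  have hgx : g x = ((∑ i, a i * k i : ℤ) : ℝ) := by
    rw [hg]
    push_cast
    exact Finset.sum_congr rfl fun i _ => by rw [hk]
  rw [← hgx]
  obtain ⟨v, hv⟩ := hF.2.1
  have hfv : f v = 1 := hv.2
  have hgv : g v = 1 := by simpa using (hfg v).1 hfv
  -- Moving `x` along `v` onto the common hyperplane shows that `f` and `g` agree at `x`.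
  have h1 : f (x + (1 - f x) • v) = 1 := by simp [hfv]
  have h2 := (hfg _).1 h1
  simp only [map_add, map_smul, hgv, smul_eq_mul, Int.cast_one] at h2
  linarith

end Hyperplanes


/-! ### Rounding down the dilation factor of a lattice point -/

section Rounding

open Filter Topology

variable {ι : Type*}

/-- For `z ≠ 0` in some dilate of a compact set, there is a last multiple of `z` in the set. -/
theorem exists_max_smul_mem [Fintype ι] {P : Set (ι → ℝ)} (hP : IsCompact P) {z : ι → ℝ} (hz : z ≠ 0)
    {r : ℝ} (hr : 0 < r) (hzr : z ∈ r • P) :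
    ∃ t : ℝ, 0 < t ∧ t • z ∈ P ∧ ∀ t', t < t' → t' • z ∉ P := by
  obtain ⟨p, hp, rfl⟩ := hzr
  have hz' : r • p ≠ 0 := hz
  obtain ⟨R, hR⟩ := hP.isBounded.exists_norm_le
  have hcl : IsClosed {t : ℝ | t • r • p ∈ P} :=
    hP.isClosed.preimage (continuous_id.smul continuous_const)
  have hsub : {t : ℝ | t • r • p ∈ P} ⊆ Metric.closedBall 0 (R / ‖r • p‖) := by
    intro t ht
    rw [mem_closedBall_zero_iff, le_div_iff₀ (norm_pos_iff.2 hz'), ← norm_smul]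
    exact hR _ ht
  have hcomp : IsCompact {t : ℝ | t • r • p ∈ P} :=
    (isCompact_closedBall _ _).of_isClosed_subset hcl hsub
  have hmem : r⁻¹ ∈ {t : ℝ | t • r • p ∈ P} := by simpa [smul_smul, hr.ne'] using hp
  obtain ⟨t, ht, hmax⟩ := hcomp.exists_isGreatest ⟨_, hmem⟩
  exact ⟨t, (inv_pos.2 hr).trans_le (hmax hmem), ht, fun t' h h' => not_le.2 h (hmax h')⟩

/-- At a boundary point on a ray through the interior of the cone over `P` there is a supporting
functional that is positive at the point. -/
theorem exists_supporting_dual {P : Set (ι → ℝ)} (hconv : Convex ℝ P) (h0 : (0 : ι → ℝ) ∈ P)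
    (hint : (interior P).Nonempty) {w : ι → ℝ} (hmax : ∀ t : ℝ, 1 < t → t • w ∉ P)
    (hneg : ∀ f : Module.Dual ℝ (ι → ℝ), f ≠ 0 → (∀ v ∈ P, f v ≤ 0) → f w < 0) :
    ∃ f : Module.Dual ℝ (ι → ℝ), (∀ v ∈ P, f v ≤ 1) ∧ f w = 1 := by
  have hwint : w ∉ interior P := by
    intro hwi
    have hcont : Tendsto (fun t : ℝ => t • w) (𝓝[>] 1) (𝓝 w) := by
      have h : ContinuousAt (fun t : ℝ => t • w) 1 := by fun_prop
      simpa using h.tendsto.mono_left nhdsWithin_le_nhds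
    obtain ⟨t, htP, ht⟩ := ((hcont.eventually (mem_interior_iff_mem_nhds.1 hwi)).and
      self_mem_nhdsWithin).exists
    exact hmax t ht htP
  obtain ⟨f, hf⟩ := geometric_hahn_banach_open_point hconv.interior isOpen_interior hwint
  have hfP : ∀ v ∈ P, f v ≤ f w := by
    intro v hv
    have hv' : v ∈ closure (interior P) := by
      rw [hconv.closure_interior_eq_closure_of_nonempty_interior hint]
      exact subset_closure hv
    exact closure_minimal (t := {v | f v ≤ f w}) (fun a ha => (hf a ha).le)
      (isClosed_le f.continuous continuous_const) hv'
  have hf0 : (f : Module.Dual ℝ (ι → ℝ)) ≠ 0 := by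
    intro h
    obtain ⟨q, hq⟩ := hint
    have h' : ∀ x, f x = 0 := fun x => LinearMap.congr_fun h x
    have := hf q hq
    rw [h', h'] at this
    exact lt_irrefl _ this
  -- `hneg` excludes a supporting hyperplane through the origin, so `f` can be normalised to `1` at
  -- `w`.
  have hpos : 0 < f w := by
    have h := hfP 0 h0
    rw [map_zero] at h
    refine h.lt_of_ne fun h' => ?_
    have := hneg f hf0 fun v hv => h' ▸ hfP v hv
    exact absurd h'.symm this.ne
  refine ⟨(f w)⁻¹ • (f : Module.Dual ℝ (ι → ℝ)), fun v hv => ?_, ?_⟩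
  · simpa [inv_mul_le_iff₀ hpos] using hfP v hv
  · simp [hpos.ne']

/-- A compactness argument that removes the perturbation by an interior point in
`mem_floor_smul_set`. -/
theorem mem_smul_set_of_forall_pos [Fintype ι] {P : Set (ι → ℝ)} (hP : IsCompact P)
    {x p : ι → ℝ} {k : ℝ}
    (h : ∀ ε : ℝ, 0 < ε → x + ε • p ∈ (k + ε) • P) : x ∈ k • P := by
  have hε : ∀ n : ℕ, (0 : ℝ) < 1 / ((n : ℝ) + 1) := fun n => Nat.one_div_pos_of_nat
  choose q hq hqe using fun n : ℕ => h _ (hε n)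
  obtain ⟨q₀, hq₀, φ, hφ, hlim⟩ := hP.tendsto_subseq hq
  have hε0 : Tendsto (fun n : ℕ => 1 / ((φ n : ℝ) + 1)) atTop (𝓝 0) :=
    tendsto_one_div_add_atTop_nhds_zero_nat.comp hφ.tendsto_atTop
  have h1 : Tendsto (fun n => (k + 1 / ((φ n : ℝ) + 1)) • (q ∘ φ) n) atTop (𝓝 ((k + 0) • q₀)) :=
    (tendsto_const_nhds.add hε0).smul hlim
  have h2 : Tendsto (fun n => x + (1 / ((φ n : ℝ) + 1)) • p) atTop (𝓝 (x + (0 : ℝ) • p)) :=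
    tendsto_const_nhds.add (hε0.smul tendsto_const_nhds)
  have h3 := tendsto_nhds_unique (h1.congr fun n => hqe (φ n)) h2
  exact ⟨q₀, hq₀, by simpa using h3⟩

theorem map_lt_zero_of_mem_interior {P : Set (ι → ℝ)} {p : ι → ℝ} (hp : p ∈ interior P)
    {f : Module.Dual ℝ (ι → ℝ)} (hf0 : f ≠ 0) (hf : ∀ v ∈ P, f v ≤ 0) : f p < 0 := by
  obtain ⟨y, hy⟩ : ∃ y, 0 < f y := by
    obtain ⟨y, hy⟩ := DFunLike.ne_iff.1 hf0
    rcases lt_or_gt_of_ne (show f y ≠ 0 from hy) with h | h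
    · exact ⟨-y, by simpa using h⟩
    · exact ⟨y, h⟩
  have hcont : Tendsto (fun t : ℝ => p + t • y) (𝓝[>] 0) (𝓝 p) := by
    have h : ContinuousAt (fun t : ℝ => p + t • y) 0 := by fun_prop
    simpa using h.tendsto.mono_left nhdsWithin_le_nhds
  obtain ⟨t, htP, ht⟩ := ((hcont.eventually (mem_interior_iff_mem_nhds.1 hp)).and
    self_mem_nhdsWithin).exists
  have h := hf _ htP
  simp only [map_add, map_smul, smul_eq_mul] at h
  have : 0 < t * f y := mul_pos ht hy
  linarith

theorem interior_nonempty_of_dim [Fintype ι] {P : Set (ι → ℝ)} (hconv : Convex ℝ P)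
    (hne : P.Nonempty) (hdim : dim P = Fintype.card ι) : (interior P).Nonempty :=
  hconv.interior_nonempty_iff_affineSpan_eq_top.2 (affineSpan_eq_top_of_dim hne hdim)

/-- If the facets of `P` have equations with right-hand side `0` or `1`, then a lattice point of
`rP` lies in `⌊r⌋P`. -/
theorem mem_floor_smul_set [Fintype ι] {P : Set (ι → ℝ)} (hP : IsPolytope P)
    (hdim : dim P = Fintype.card ι) (h0 : (0 : ι → ℝ) ∈ P) (hfac : HasZeroOneFacetEquations P)
    {x : ι → ℝ}
    (hx : x ∈ integerPoints ι) {r : ℝ} (hr : 0 ≤ r) (hxr : x ∈ r • P) :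
    x ∈ (⌊r⌋₊ : ℝ) • P := by
  obtain ⟨S, hS, rfl⟩ := hP
  set P := convexHull ℝ S with hPdef
  have hconv : Convex ℝ P := convex_convexHull ℝ S
  have hcomp : IsCompact P := hS.isCompact_convexHull ℝ
  have hint := interior_nonempty_of_dim hconv ⟨0, h0⟩ hdim
  obtain ⟨p, hp⟩ := hint
  -- The origin may lie on the boundary of `P`, and `x` on the boundary of the cone over `P`. Adding
  -- `ε • p` moves it inside the cone, so that its ray leaves `P` through a facet off the origin.
  refine mem_smul_set_of_forall_pos (p := p) hcomp fun ε hε => ?_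
  have hfl : (0 : ℝ) ≤ ⌊r⌋₊ := Nat.cast_nonneg _
  rcases eq_or_ne (x + ε • p) 0 with hz | hz
  · rw [hz]
    exact ⟨0, h0, smul_zero _⟩
  have hzr : x + ε • p ∈ (r + ε) • P := by
    rw [hconv.add_smul hr hε.le]
    exact Set.add_mem_add hxr (Set.smul_mem_smul_set (interior_subset hp))
  obtain ⟨t, ht, htP, htmax⟩ := exists_max_smul_mem hcomp hz (by linarith) hzr
  obtain ⟨l, hl, hlw⟩ := exists_supporting_dual hconv h0 ⟨p, hp⟩
    (fun s hs h => htmax (s * t) (by nlinarith) (by rwa [mul_smul])) (by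
      intro f hf0 hf
      have hfx := le_of_mem_smul_set hf hr hxr
      have hfp := mul_neg_of_pos_of_neg hε (map_lt_zero_of_mem_interior hp hf0 hf)
      rw [map_smul, smul_eq_mul, map_add, map_smul, smul_eq_mul]
      exact mul_neg_of_pos_of_neg ht (by linarith))
  obtain ⟨k, hk, hkw, hkspan⟩ := exists_dual_span_tight_eq_top hS
    (span_eq_top_of_dim_convexHull ⟨0, h0⟩ hdim) htP
    (fun v hv => hl v (subset_convexHull ℝ S hv)) hlw
  have hkP : ∀ v ∈ P, k v ≤ 1 := le_on_convexHull hk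
  have hfacet := isFacet_of_span_tight_eq_top hdim hkP htP hkw
    ((Set.sep_subset _ _).trans (subset_convexHull ℝ S)) (fun v hv => hv.2) hkspan
  have hk0 : k ≠ 0 := by
    rintro rfl
    simp at hkw
  obtain ⟨a, ha⟩ := exists_int_eq_of_hasZeroOneFacetEquations hfac hdim hk0 hfacet hx
  have hax : k x ≤ ⌊r⌋₊ := by
    have h1 : k x ≤ r := by simpa using le_of_mem_smul_set hkP hr hxr
    rw [natCast_floor_eq_intCast_floor hr, ha]
    rw [ha] at h1
    exact_mod_cast Int.le_floor.2 h1
  have hkz : k (x + ε • p) = t⁻¹ := by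
    rw [map_smul, smul_eq_mul] at hkw
    exact eq_inv_of_mul_eq_one_right hkw
  -- `t⁻¹` is the least dilation factor reaching `x + ε • p`, and the facet functional `k` computes
  -- it.
  have hle : t⁻¹ ≤ ⌊r⌋₊ + ε := by
    rw [← hkz, map_add, map_smul, smul_eq_mul]
    nlinarith [hkP p (interior_subset hp)]
  refine smul_set_mono hconv h0 (inv_pos.2 ht).le hle ⟨_, htP, ?_⟩
  simp [smul_smul, ht.ne']

end Rounding


/-! ### Facet equations recovered from rounding -/

section Lattice

/-- The integer points form a group. -/
def integerLattice (ι : Type*) : AddSubgroup (ι → ℝ) where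
  carrier := integerPoints ι
  zero_mem' := fun _ => ⟨0, by simp⟩
  add_mem' := fun {x y} hx hy i => by
    obtain ⟨a, ha⟩ := hx i
    obtain ⟨b, hb⟩ := hy i
    exact ⟨a + b, by simp [ha, hb]⟩
  neg_mem' := fun {x} hx i => by
    obtain ⟨a, ha⟩ := hx i
    exact ⟨-a, by simp [ha]⟩

theorem single_mem_integerPoints {ι : Type*} [DecidableEq ι] (i : ι) :
    (Pi.single i 1 : ι → ℝ) ∈ integerPoints ι := by
  intro j
  rcases eq_or_ne j i with rfl | h
  · exact ⟨1, by simp⟩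
  · exact ⟨0, by simp [h]⟩

variable {ι : Type*}

/-- A nonzero real functional vanishing on a set of lattice points can be replaced by a nonzero
integral one. -/
theorem exists_int_dual_of_dual [Fintype ι] [DecidableEq ι] {E : Set (ι → ℝ)}
    (hE : E ⊆ integerPoints ι)
    {l : Module.Dual ℝ (ι → ℝ)} (hl0 : l ≠ 0) (hl : ∀ v ∈ E, l v = 0) :
    ∃ a : ι → ℤ, a ≠ 0 ∧ ∀ v ∈ E, ∑ i, (a i : ℝ) * v i = 0 := by
  obtain ⟨i₀, hi₀⟩ : ∃ i, l (Pi.single i 1) ≠ 0 := by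
    by_contra! h
    exact hl0 (LinearMap.pi_ext' fun i => LinearMap.ext_ring (by simpa using h i))
  -- Applying a `ℚ`-linear map `ℝ → ℚ` to the coefficients of `l` preserves its relations with
  -- lattice vectors. Clearing denominators then makes the coefficients integral.
  obtain ⟨φ, hφ⟩ : ∃ φ : Module.Dual ℚ ℝ, φ (l (Pi.single i₀ 1)) ≠ 0 := by
    by_contra! h
    exact hi₀ ((Module.forall_dual_apply_eq_zero_iff ℚ _).1 h)
  obtain ⟨⟨b, hb⟩, hbi⟩ := IsLocalization.exist_integer_multiples (nonZeroDivisors ℤ) Finset.univ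
    fun i => φ (l (Pi.single i 1))
  choose a ha using fun i => hbi i (Finset.mem_univ i)
  have ha' : ∀ i, (a i : ℚ) = b * φ (l (Pi.single i 1)) := fun i => by simpa using ha i
  have hb0 : b ≠ 0 := nonZeroDivisors.ne_zero hb
  refine ⟨a, fun h => ?_, fun v hv => ?_⟩
  · have := ha' i₀
    rw [h] at this
    simp [hb0, hφ] at this
  · choose z hz using hE hv
    have h1 : ∑ i, (z i : ℚ) • l (Pi.single i 1) = 0 := by
      rw [← hl v hv]
      conv_rhs => rw [pi_eq_sum_univ' v]
      rw [map_sum]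
      refine Finset.sum_congr rfl fun i _ => ?_
      rw [map_smul, hz, Rat.smul_def]
      simp [Pi.single, smul_eq_mul]
    have h2 : ∑ i, (a i : ℚ) * z i = 0 := by
      have := congrArg φ h1
      simp only [map_sum, map_smul, smul_eq_mul, map_zero] at this
      calc ∑ i, (a i : ℚ) * z i = b * ∑ i, (z i : ℚ) * φ (l (Pi.single i 1)) := by
            rw [Finset.mul_sum]
            exact Finset.sum_congr rfl fun i _ => by rw [ha']; ring
        _ = 0 := by rw [this, mul_zero]
    have h3 : ∑ i, (a i : ℝ) * z i = 0 := by exact_mod_cast h2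
    rw [← h3]
    exact Finset.sum_congr rfl fun i _ => by rw [hz]

theorem span_eq_top_of_affineSpan_eq {V : Type*} [AddCommGroup V] [Module ℝ V] {E : Set V}
    {k : Module.Dual ℝ V} {v : V} (hv : k v = 1)
    (hE : (affineSpan ℝ E : Set V) = {z | k z = 1}) : Submodule.span ℝ E = ⊤ := by
  have hsub : ∀ z, k z = 1 → z ∈ Submodule.span ℝ E := by
    intro z hz
    refine affineSpan_subset_span ?_
    rw [hE]
    exact hz
  refine top_le_iff.1 fun z _ => ?_
  have hz : z = (z + (1 - k z) • v) - (1 - k z) • v := by abel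
  rw [hz]
  exact sub_mem (hsub _ (by simp [hv])) (Submodule.smul_mem _ _ (hsub v hv))

/-- Krein–Milman for the face: its extreme points are among those of `P`, hence integral and finite
in number. -/
theorem exists_finset_extremePoints [Finite ι] {P F : Set (ι → ℝ)} (hP : IsIntegralPolytope P)
    (hF : IsExposed ℝ P F) : ∃ E : Finset (ι → ℝ), (E : Set (ι → ℝ)) ⊆ integerPoints ι ∧
      F = convexHull ℝ (E : Set (ι → ℝ)) := by
  obtain ⟨⟨S, hS, rfl⟩, hint⟩ := hP
  have hsub := hF.isExtreme.extremePoints_subset_extremePoints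
  have hfin : (F.extremePoints ℝ).Finite := hS.subset (hsub.trans extremePoints_convexHull_subset)
  refine ⟨hfin.toFinset, by simpa using hsub.trans hint, ?_⟩
  rw [hfin.coe_toFinset, ← (hfin.isCompact_convexHull ℝ).isClosed.closure_eq]
  exact (closure_convexHull_extremePoints (hF.isCompact (hS.isCompact_convexHull ℝ))
    (hF.convex (convex_convexHull ℝ S))).symm

/-- Adding a large multiple of the sum of `E` to `u` makes all coefficients over `E` nonnegative and
shifts `k u` by an integer. The resulting `x` lies in `k x • P`, so a fractional part at most `1/2`
lets `hround` apply with `m = ⌊k x⌋₊`. This gives `k x ≤ ⌊k x⌋₊`. -/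
theorem fract_eq_zero_of_spanning {P : Set (ι → ℝ)} (hconv : Convex ℝ P) (h0 : (0 : ι → ℝ) ∈ P)
    (hround : ∀ x ∈ integerPoints ι, ∀ m : ℕ, x ∈ ((m : ℝ) + 1 / 2) • P → x ∈ (m : ℝ) • P)
    {k : Module.Dual ℝ (ι → ℝ)} (hkP : ∀ v ∈ P, k v ≤ 1) {E : Finset (ι → ℝ)}
    (hE : (E : Set (ι → ℝ)) ⊆ integerPoints ι) (hEP : (E : Set (ι → ℝ)) ⊆ P)
    (hkE : ∀ v ∈ E, k v = 1) (hspan : Submodule.span ℝ (E : Set (ι → ℝ)) = ⊤)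
    {u : ι → ℝ} (hu : u ∈ integerPoints ι) (hfr : Int.fract (k u) ≤ 1 / 2) :
    Int.fract (k u) = 0 := by
  obtain ⟨w, -, hw⟩ := Submodule.mem_span_finset.1 (hspan ▸ Submodule.mem_top : u ∈ _)
  obtain ⟨N, hN⟩ := exists_nat_ge (∑ v ∈ E, |w v|)
  have hpos : ∀ v ∈ E, 0 ≤ w v + N := by
    intro v hv
    have h1 : |w v| ≤ N :=
      (Finset.single_le_sum (f := fun v => |w v|) (fun _ _ => abs_nonneg _) hv).trans hN
    linarith [neg_abs_le (w v)]
  set x := ∑ v ∈ E, (w v + N) • v with hxdef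
  have hx : x = u + N • ∑ v ∈ E, v := by
    rw [hxdef, ← hw, Finset.smul_sum, ← Finset.sum_add_distrib]
    exact Finset.sum_congr rfl fun v _ => by rw [add_smul, Nat.cast_smul_eq_nsmul]
  have hxint : x ∈ integerLattice ι := by
    rw [hx]
    exact add_mem hu (nsmul_mem (sum_mem fun v hv => hE hv) _)
  have hkx : k x = ∑ v ∈ E, (w v + N) := by
    rw [hxdef, map_sum]
    exact Finset.sum_congr rfl fun v hv => by rw [map_smul, hkE v hv, smul_eq_mul, mul_one]
  have hkx' : k x = k u + ((N * E.card : ℕ) : ℝ) := by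
    rw [hx, map_add, map_nsmul, map_sum, Finset.sum_congr rfl hkE]
    simp
  have hmem : x ∈ k x • P := by
    rw [hkx]
    exact sum_smul_mem_smul_set hconv h0 E _ _ hpos fun v hv => hEP hv
  have hk0 : 0 ≤ k x := hkx ▸ Finset.sum_nonneg hpos
  have hfx : Int.fract (k x) = Int.fract (k u) := by rw [hkx', Int.fract_add_natCast]
  have hfloor : (⌊k x⌋₊ : ℝ) + Int.fract (k x) = k x := by
    rw [natCast_floor_eq_intCast_floor hk0, Int.floor_add_fract]
  have h1 := hround x hxint ⌊k x⌋₊ (smul_set_mono hconv h0 hk0 (by linarith) hmem)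
  have h2 := le_of_mem_smul_set hkP (Nat.cast_nonneg _) h1
  rw [← hfx]
  linarith [Int.fract_nonneg (k x)]

/-- If lattice points of `(m + 1/2)P` always lie in `mP`, then the facets of `P` have integral
equations with right-hand side `0` or `1`. -/
theorem hasZeroOneFacetEquations_of_round [Fintype ι] {P : Set (ι → ℝ)}
    (hP : IsIntegralPolytope P) (hdim : dim P = Fintype.card ι) (h0 : (0 : ι → ℝ) ∈ P)
    (hround : ∀ x ∈ integerPoints ι, ∀ m : ℕ, x ∈ ((m : ℝ) + 1 / 2) • P → x ∈ (m : ℝ) • P) :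
    HasZeroOneFacetEquations P := by
  classical
  rintro F ⟨hexp, hne, hFdim⟩
  have hconv : Convex ℝ P := by
    obtain ⟨⟨S, -, rfl⟩, -⟩ := hP
    exact convex_convexHull ℝ S
  obtain ⟨E, hE, hFE⟩ := exists_finset_extremePoints hP hexp
  have hEF : (E : Set (ι → ℝ)) ⊆ F := hFE ▸ subset_convexHull ℝ _
  obtain ⟨l, hl⟩ := hexp hne
  obtain ⟨v₀, hv₀⟩ := hne
  have hFP : F ⊆ P := hexp.subset
  let f : Module.Dual ℝ (ι → ℝ) := l
  have hfP : ∀ y ∈ P, f y ≤ f v₀ := (hl ▸ hv₀ : v₀ ∈ {x ∈ P | ∀ y ∈ P, l y ≤ l x}).2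
  have hfF : ∀ v ∈ F, f v = f v₀ := fun v hv =>
    le_antisymm (hfP v (hFP hv)) ((hl ▸ hv : v ∈ {x ∈ P | ∀ y ∈ P, l y ≤ l x}).2 v₀ (hFP hv₀))
  have hf0 : f ≠ 0 := by
    intro h
    have h' : ∀ x, l x = 0 := fun x => LinearMap.congr_fun h x
    have : F = P := by
      rw [hl]
      simp [h']
    rw [this] at hFdim
    omega
  have hdim' := hFdim.trans hdim
  have hc : 0 ≤ f v₀ := by simpa using hfP 0 h0
  rcases hc.eq_or_lt with hc | hc
  -- A facet hyperplane through the origin only needs an integral normal vector; rounding plays no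
  -- role.
  · obtain ⟨a, ha0, ha⟩ := exists_int_dual_of_dual hE hf0 fun v hv => (hfF v (hEF hv)).trans hc.symm
    obtain ⟨g, hg⟩ := exists_dual_eq_sum_mul fun i => (a i : ℝ)
    refine ⟨a, 0, Or.inl rfl, ?_⟩
    have hg0 : g ≠ 0 := by
      rintro rfl
      refine ha0 (funext fun i => ?_)
      have := hg (Pi.single i 1)
      simpa [Pi.single_apply] using this.symm
    rw [affineSpan_eq_of_dim_add_one ⟨v₀, hv₀⟩ hdim' hg0 (c := 0)]
    · simp [hg]
    · rw [hFE]
      refine fun v hv => convexHull_min (t := {v | g v = 0}) (fun v hv => ?_)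
        (convex_hyperplane g.isLinear 0) hv
      exact (hg v).trans (ha v hv)
  · set k : Module.Dual ℝ (ι → ℝ) := (f v₀)⁻¹ • f with hk
    have hkv : ∀ x, k x = (f v₀)⁻¹ * f x := fun x => rfl
    have hkF : ∀ v ∈ F, k v = 1 := fun v hv => by rw [hkv, hfF v hv, inv_mul_cancel₀ hc.ne']
    have hkP : ∀ v ∈ P, k v ≤ 1 := fun v hv => by
      rw [hkv, inv_mul_le_iff₀ hc, mul_one]
      exact hfP v hv
    have hk0 : k ≠ 0 := by
      intro h
      have := hkF v₀ hv₀
      simp [h] at this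
    have haff := affineSpan_eq_of_dim_add_one ⟨v₀, hv₀⟩ hdim' hk0 hkF
    have hspan : Submodule.span ℝ (E : Set (ι → ℝ)) = ⊤ := by
      refine span_eq_top_of_affineSpan_eq (hkF v₀ hv₀) ?_
      rw [← haff, hFE, affineSpan_convexHull]
    have hfract : ∀ u ∈ integerPoints ι, Int.fract (k u) ≤ 1 / 2 → Int.fract (k u) = 0 :=
      fun u hu => fract_eq_zero_of_spanning hconv h0 hround hkP hE (hEF.trans hFP)
        (fun v hv => hkF v (hEF hv)) hspan hu
    have hint : ∀ u ∈ integerPoints ι, Int.fract (k u) = 0 := by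
      intro u hu
      rcases le_or_gt (Int.fract (k u)) (1 / 2) with h | h
      · exact hfract u hu h
      -- A nonintegral value has fractional parts at `u` and `-u` adding up to `1`, so one of them
      -- is at most `1/2`.
      · by_contra hne
        have h1 := hfract (-u) ((integerLattice ι).neg_mem hu)
        rw [map_neg, Int.fract_neg hne] at h1
        linarith [h1 (by linarith), Int.fract_lt_one (k u)]
    have ha : ∀ i, k (Pi.single i 1) = (⌊k (Pi.single i 1)⌋ : ℝ) := fun i => by
      conv_lhs => rw [← Int.floor_add_fract (k (Pi.single i 1)),
        hint _ (single_mem_integerPoints i), add_zero]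
    refine ⟨fun i => ⌊k (Pi.single i 1)⌋, 1, Or.inr rfl, ?_⟩
    rw [haff]
    ext z
    have hz : k z = ∑ i, (⌊k (Pi.single i 1)⌋ : ℝ) * z i := by
      conv_lhs => rw [← Finset.univ_sum_single z, map_sum]
      refine Finset.sum_congr rfl fun i _ => ?_
      have hs : (Pi.single i (z i) : ι → ℝ) = z i • Pi.single i 1 := by simp [← Pi.single_smul]
      rw [← ha, hs, map_smul, smul_eq_mul, mul_comm]
    simp [hz]

end Lattice


/-! ### Lattice points and decompositions in the free sum -/

section FreeSum

variable {d e : ℕ}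

/-- The projection of `ℝ^(d+e)` to the first `d` coordinates. -/
def fstProj (d e : ℕ) : (Fin (d + e) → ℝ) →ₗ[ℝ] (Fin d → ℝ) :=
  LinearMap.funLeft ℝ ℝ (Fin.castAdd e)

/-- The projection of `ℝ^(d+e)` to the last `e` coordinates. -/
def sndProj (d e : ℕ) : (Fin (d + e) → ℝ) →ₗ[ℝ] (Fin e → ℝ) :=
  LinearMap.funLeft ℝ ℝ (Fin.natAdd d)

theorem fstProj_append (x : Fin d → ℝ) (y : Fin e → ℝ) : fstProj d e (Fin.append x y) = x := by
  ext i
  simp [fstProj, LinearMap.funLeft_apply]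

theorem sndProj_append (x : Fin d → ℝ) (y : Fin e → ℝ) : sndProj d e (Fin.append x y) = y := by
  ext i
  simp [sndProj, LinearMap.funLeft_apply]

theorem ext_proj {z w : Fin (d + e) → ℝ} (h1 : fstProj d e z = fstProj d e w)
    (h2 : sndProj d e z = sndProj d e w) : z = w := by
  ext i
  induction i using Fin.addCases with
  | left i => exact congrFun h1 i
  | right i => exact congrFun h2 i

theorem isLinearMap_inlMap : IsLinearMap ℝ (inlMap d e) where
  map_add x y := ext_proj (by simp [inlMap, fstProj_append]) (by simp [inlMap, sndProj_append])
  map_smul c x := ext_proj (by simp [inlMap, fstProj_append]) (by simp [inlMap, sndProj_append])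

theorem isLinearMap_inrMap : IsLinearMap ℝ (inrMap d e) where
  map_add x y := ext_proj (by simp [inrMap, fstProj_append]) (by simp [inrMap, sndProj_append])
  map_smul c x := ext_proj (by simp [inrMap, fstProj_append]) (by simp [inrMap, sndProj_append])

theorem append_mem_integerPoints {x : Fin d → ℝ} {y : Fin e → ℝ} (hx : x ∈ integerPoints (Fin d))
    (hy : y ∈ integerPoints (Fin e)) : Fin.append x y ∈ integerPoints (Fin (d + e)) := by
  intro i
  induction i using Fin.addCases with
  | left i => simpa using hx i
  | right i => simpa using hy i

theorem fstProj_mem_integerPoints {z : Fin (d + e) → ℝ} (hz : z ∈ integerPoints (Fin (d + e))) :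
    fstProj d e z ∈ integerPoints (Fin d) := fun i => hz (Fin.castAdd e i)

theorem sndProj_mem_integerPoints {z : Fin (d + e) → ℝ} (hz : z ∈ integerPoints (Fin (d + e))) :
    sndProj d e z ∈ integerPoints (Fin e) := fun i => hz (Fin.natAdd d i)

variable {P : Set (Fin d → ℝ)} {Q : Set (Fin e → ℝ)}

theorem inlMap_mem_freeSum {x : Fin d → ℝ} (hx : x ∈ P) : inlMap d e x ∈ freeSum P Q :=
  subset_convexHull ℝ _ (Or.inl ⟨x, hx, rfl⟩)

theorem inrMap_mem_freeSum {y : Fin e → ℝ} (hy : y ∈ Q) : inrMap d e y ∈ freeSum P Q :=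
  subset_convexHull ℝ _ (Or.inr ⟨y, hy, rfl⟩)

theorem append_mem_smul_freeSum {r s : ℝ} (hr : 0 ≤ r) (hs : 0 ≤ s) {x : Fin d → ℝ}
    {y : Fin e → ℝ} (hx : x ∈ r • P) (hy : y ∈ s • Q) :
    Fin.append x y ∈ (r + s) • freeSum P Q := by
  obtain ⟨p, hp, rfl⟩ := hx
  obtain ⟨q, hq, rfl⟩ := hy
  have hconv : Convex ℝ (freeSum P Q) := convex_convexHull ℝ _
  rw [hconv.add_smul hr hs]
  refine ⟨r • inlMap d e p, Set.smul_mem_smul_set (inlMap_mem_freeSum hp), s • inrMap d e q,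
    Set.smul_mem_smul_set (inrMap_mem_freeSum hq), ext_proj ?_ ?_⟩ <;>
  simp [inlMap, inrMap, fstProj_append, sndProj_append]

theorem exists_of_mem_freeSum (hP : Convex ℝ P) (hQ : Convex ℝ Q) (hP0 : P.Nonempty)
    (hQ0 : Q.Nonempty) {z : Fin (d + e) → ℝ} (hz : z ∈ freeSum P Q) :
    ∃ s t : ℝ, 0 ≤ s ∧ 0 ≤ t ∧ s + t = 1 ∧ fstProj d e z ∈ s • P ∧ sndProj d e z ∈ t • Q := by
  rw [freeSum, (hP.is_linear_image isLinearMap_inlMap).convexHull_union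
    (hQ.is_linear_image isLinearMap_inrMap) (hP0.image _) (hQ0.image _), mem_convexJoin] at hz
  obtain ⟨_, ⟨p, hp, rfl⟩, _, ⟨q, hq, rfl⟩, s, t, hs, ht, hst, rfl⟩ := hz
  refine ⟨s, t, hs, ht, hst, ⟨p, hp, ?_⟩, ⟨q, hq, ?_⟩⟩ <;>
  simp [inlMap, inrMap, fstProj_append, sndProj_append]

theorem mem_of_mem_smul_set {V : Type*} [AddCommGroup V] [Module ℝ V] {P : Set V}
    (hP : Convex ℝ P) (h0 : (0 : V) ∈ P) {s : ℝ} (hs : 0 ≤ s) (hs1 : s ≤ 1) {x : V}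
    (hx : x ∈ s • P) : x ∈ P := by
  simpa using smul_set_mono hP h0 hs hs1 hx

theorem IsZeroOnePolytope.mem_Icc {ι : Type*} {P : Set (ι → ℝ)} (hP : IsZeroOnePolytope P)
    {x : ι → ℝ} (hx : x ∈ P) (i : ι) : 0 ≤ x i ∧ x i ≤ 1 := by
  obtain ⟨⟨S, hS, rfl⟩, hv⟩ := hP
  rw [← closure_convexHull_extremePoints (hS.isCompact_convexHull ℝ) (convex_convexHull ℝ S)] at hx
  have hsub : closure (convexHull ℝ ((convexHull ℝ S).extremePoints ℝ)) ⊆ Set.Icc 0 1 := by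
    refine closure_minimal (convexHull_min (fun v hvS => ?_) (convex_Icc 0 1)) isClosed_Icc
    constructor <;> intro j <;> rcases hv v hvS j with h | h <;> simp [h]
  exact ⟨(hsub hx).1 i, (hsub hx).2 i⟩

theorem IsZeroOnePolytope.isIntegralPolytope {ι : Type*} {P : Set (ι → ℝ)}
    (hP : IsZeroOnePolytope P) : IsIntegralPolytope P := by
  refine ⟨hP.1, fun v hv i => ?_⟩
  rcases hP.2 v hv i with h | h
  · exact ⟨0, by simp [h]⟩
  · exact ⟨1, by simp [h]⟩

/-- The lattice points of the free sum of a `(0,1)`-polytope and `Q` lie on the two summands. -/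
theorem lattice_point_freeSum (hP : IsZeroOnePolytope P) (hPc : Convex ℝ P) (hQ : Convex ℝ Q)
    (hP0 : (0 : Fin d → ℝ) ∈ P) (hQ0 : (0 : Fin e → ℝ) ∈ Q) {z : Fin (d + e) → ℝ}
    (hz : z ∈ freeSum P Q) (hzi : z ∈ integerPoints (Fin (d + e))) :
    (fstProj d e z ∈ P ∧ sndProj d e z = 0) ∨ (fstProj d e z = 0 ∧ sndProj d e z ∈ Q) := by
  obtain ⟨s, t, hs, ht, hst, hx, hy⟩ := exists_of_mem_freeSum hPc hQ ⟨0, hP0⟩ ⟨0, hQ0⟩ hz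
  by_cases h : fstProj d e z = 0
  · exact Or.inr ⟨h, mem_of_mem_smul_set hQ hQ0 ht (by linarith) hy⟩
  · left
    refine ⟨mem_of_mem_smul_set hPc hP0 hs (by linarith) hx, ?_⟩
    obtain ⟨i, hi⟩ := Function.ne_iff.1 h
    obtain ⟨k, hk⟩ := fstProj_mem_integerPoints hzi i
    obtain ⟨p, hp, hpx⟩ := hx
    have hpi : s * p i = k := by
      rw [← hk, ← hpx]
      rfl
    have hpI := hP.mem_Icc hp i
    have hk0 : k ≠ 0 := by
      rintro rfl
      exact hi (by simpa using hk)
    have hk1 : (1 : ℝ) ≤ k := by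
      have : (0 : ℝ) ≤ k := hpi ▸ mul_nonneg hs hpI.1
      have : 0 ≤ k := by exact_mod_cast this
      have : 1 ≤ k := by omega
      exact_mod_cast this
    -- A nonzero integral coordinate equals `s * p i ≤ s`, so all the weight falls on `P`.
    have hs1 : 1 ≤ s := by nlinarith [hpI.2]
    have ht0 : t = 0 := by linarith
    rw [ht0, Set.zero_smul_set ⟨0, hQ0⟩] at hy
    exact hy

/-- Covers the dilation factor `0`, which occurs when a split puts all of `n` on one side. -/
theorem HasIDP.exists_sum {ι : Type*} {P : Set (ι → ℝ)} (hP : HasIDP P) {k : ℕ} {x : ι → ℝ}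
    (hx : x ∈ (k : ℝ) • P) (hxi : x ∈ integerPoints ι) :
    ∃ g : Fin k → (ι → ℝ), (∀ j, g j ∈ P ∩ integerPoints ι) ∧ x = ∑ j, g j := by
  rcases Nat.eq_zero_or_pos k with rfl | hk
  · obtain ⟨p, -, rfl⟩ := hx
    exact ⟨Fin.elim0, fun j => j.elim0, by simp⟩
  · exact hP k hk x ⟨hx, hxi⟩

theorem exists_split (hPc : Convex ℝ P) (hQc : Convex ℝ Q) (hP0 : (0 : Fin d → ℝ) ∈ P)
    (hQ0 : (0 : Fin e → ℝ) ∈ Q) {n : ℕ} {γ : Fin (d + e) → ℝ}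
    (hγ : γ ∈ (n : ℝ) • freeSum P Q) :
    ∃ r s : ℝ, 0 ≤ r ∧ 0 ≤ s ∧ r + s = n ∧ fstProj d e γ ∈ r • P ∧ sndProj d e γ ∈ s • Q := by
  obtain ⟨z, hz, rfl⟩ := hγ
  obtain ⟨s, t, hs, ht, hst, hx, hy⟩ := exists_of_mem_freeSum hPc hQc ⟨0, hP0⟩ ⟨0, hQ0⟩ hz
  refine ⟨n * s, n * t, by positivity, by positivity, by rw [← mul_add, hst, mul_one], ?_, ?_⟩
  · rw [map_smul, mul_smul]
    exact Set.smul_mem_smul_set hx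
  · rw [map_smul, mul_smul]
    exact Set.smul_mem_smul_set hy

/-- Rounding `r` down leaves `n - ⌊r⌋₊ ≥ s`, so only one of the two summands needs the rounding
property. -/
theorem exists_floor_split {V : Type*} [AddCommGroup V] [Module ℝ V] {Q : Set V}
    (hQc : Convex ℝ Q) (hQ0 : (0 : V) ∈ Q) {n : ℕ} {r s : ℝ} (hr : 0 ≤ r) (hs : 0 ≤ s)
    (hrs : r + s = n) {y : V} (hy : y ∈ s • Q) :
    ∃ m : ℕ, ⌊r⌋₊ + m = n ∧ y ∈ (m : ℝ) • Q := by
  have hfl := Nat.floor_le hr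
  have hle : ⌊r⌋₊ ≤ n := by
    have : (⌊r⌋₊ : ℝ) ≤ n := by linarith
    exact_mod_cast this
  refine ⟨n - ⌊r⌋₊, by omega, smul_set_mono hQc hQ0 hs ?_ hy⟩
  rw [Nat.cast_sub hle]
  linarith

theorem hasIDP_freeSum (hPI : HasIDP P) (hQI : HasIDP Q)
    (hsplit : ∀ γ ∈ integerPoints (Fin (d + e)), ∀ n : ℕ, γ ∈ (n : ℝ) • freeSum P Q →
      ∃ k m : ℕ, k + m = n ∧ fstProj d e γ ∈ (k : ℝ) • P ∧ sndProj d e γ ∈ (m : ℝ) • Q) :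
    HasIDP (freeSum P Q) := by
  rintro n - γ ⟨hγ, hγi⟩
  obtain ⟨k, m, rfl, hx, hy⟩ := hsplit γ hγi n hγ
  obtain ⟨g, hg, hgs⟩ := hPI.exists_sum hx (fstProj_mem_integerPoints hγi)
  obtain ⟨h, hh, hhs⟩ := hQI.exists_sum hy (sndProj_mem_integerPoints hγi)
  refine ⟨Fin.append (fun j => inlMap d e (g j)) (fun j => inrMap d e (h j)), fun j => ?_,
    ext_proj ?_ ?_⟩
  · induction j using Fin.addCases with
    | left j =>
      rw [Fin.append_left]
      exact ⟨inlMap_mem_freeSum (hg j).1,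
        append_mem_integerPoints (hg j).2 (integerLattice (Fin e)).zero_mem⟩
    | right j =>
      rw [Fin.append_right]
      exact ⟨inrMap_mem_freeSum (hh j).1,
        append_mem_integerPoints (integerLattice (Fin d)).zero_mem (hh j).2⟩
  · rw [hgs, map_sum, Fin.sum_univ_add]
    simp [inlMap, inrMap, fstProj_append]
  · rw [hhs, map_sum, Fin.sum_univ_add]
    simp [inlMap, inrMap, sndProj_append]

theorem hasIDP_fst_of_freeSum (hQ0 : (0 : Fin e → ℝ) ∈ Q)
    (hfst : ∀ z ∈ freeSum P Q ∩ integerPoints (Fin (d + e)), fstProj d e z ∈ P)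
    (h : HasIDP (freeSum P Q)) : HasIDP P := by
  rintro n hn x ⟨hx, hxi⟩
  have hmem : Fin.append x (0 : Fin e → ℝ) ∈ (n : ℝ) • freeSum P Q := by
    have := append_mem_smul_freeSum (Q := Q) (y := 0) (Nat.cast_nonneg n) le_rfl hx
      ⟨0, hQ0, smul_zero _⟩
    rwa [add_zero] at this
  obtain ⟨g, hg, hgs⟩ := h n hn _
    ⟨hmem, append_mem_integerPoints hxi (integerLattice (Fin e)).zero_mem⟩
  refine ⟨fun j => fstProj d e (g j), fun j =>
    ⟨hfst _ (hg j), fstProj_mem_integerPoints (hg j).2⟩, ?_⟩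
  rw [← map_sum, ← hgs, fstProj_append]

theorem hasIDP_snd_of_freeSum (hP0 : (0 : Fin d → ℝ) ∈ P)
    (hsnd : ∀ z ∈ freeSum P Q ∩ integerPoints (Fin (d + e)), sndProj d e z ∈ Q)
    (h : HasIDP (freeSum P Q)) : HasIDP Q := by
  rintro n hn y ⟨hy, hyi⟩
  have hmem : Fin.append (0 : Fin d → ℝ) y ∈ (n : ℝ) • freeSum P Q := by
    have := append_mem_smul_freeSum (P := P) (x := 0) le_rfl (Nat.cast_nonneg n)
      ⟨0, hP0, smul_zero _⟩ hy
    rwa [zero_add] at this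
  obtain ⟨g, hg, hgs⟩ := h n hn _
    ⟨hmem, append_mem_integerPoints (integerLattice (Fin d)).zero_mem hyi⟩
  refine ⟨fun j => sndProj d e (g j), fun j =>
    ⟨hsnd _ (hg j), sndProj_mem_integerPoints (hg j).2⟩, ?_⟩
  rw [← map_sum, ← hgs, sndProj_append]

/-- A lattice point of a dilated free sum with the integer decomposition property splits the
dilation factor into two natural numbers. -/
theorem exists_nat_split_of_hasIDP (hPc : Convex ℝ P) (hQc : Convex ℝ Q)
    (hP0 : (0 : Fin d → ℝ) ∈ P) (hQ0 : (0 : Fin e → ℝ) ∈ Q)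
    (hlat : ∀ z ∈ freeSum P Q ∩ integerPoints (Fin (d + e)),
      (fstProj d e z ∈ P ∧ sndProj d e z = 0) ∨ (fstProj d e z = 0 ∧ sndProj d e z ∈ Q))
    (h : HasIDP (freeSum P Q)) {γ : Fin (d + e) → ℝ} (hγi : γ ∈ integerPoints (Fin (d + e)))
    {n : ℕ} (hn : 1 ≤ n) (hγ : γ ∈ (n : ℝ) • freeSum P Q) :
    ∃ k m : ℕ, k + m = n ∧ fstProj d e γ ∈ (k : ℝ) • P ∧ sndProj d e γ ∈ (m : ℝ) • Q := by
  classical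
  obtain ⟨g, hg, rfl⟩ := h n hn γ ⟨hγ, hγi⟩
  -- The sizes of `A` and its complement give the split; a zero summand, which fits both
  -- alternatives, is counted in `A`.
  let A : Finset (Fin n) := {j | fstProj d e (g j) ∈ P ∧ sndProj d e (g j) = 0}
  have hA : ∀ j ∈ A, fstProj d e (g j) ∈ P ∧ sndProj d e (g j) = 0 := fun j hj => by
    simpa [A] using hj
  have hAc : ∀ j ∈ Aᶜ, fstProj d e (g j) = 0 ∧ sndProj d e (g j) ∈ Q := fun j hj =>
    (hlat _ (hg j)).resolve_left fun h => Finset.mem_compl.1 hj (by simpa [A] using h)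
  refine ⟨A.card, Aᶜ.card, by rw [Finset.card_add_card_compl, Fintype.card_fin], ?_, ?_⟩
  · rw [map_sum, ← Finset.sum_add_sum_compl A, Finset.sum_eq_zero (s := Aᶜ) fun j hj => (hAc j hj).1,
      add_zero]
    exact sum_mem_card_smul_set hPc hP0 A _ fun j hj => (hA j hj).1
  · rw [map_sum, ← Finset.sum_add_sum_compl A, Finset.sum_eq_zero (s := A) fun j hj => (hA j hj).2,
      zero_add]
    exact sum_mem_card_smul_set hQc hQ0 Aᶜ _ fun j hj => (hAc j hj).2

end FreeSum

end LatticePolytope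

/-! ### The characterisation -/

open LatticePolytope in
theorem mainTheorem3 (d e : ℕ) (P : Set (Fin d → ℝ)) (Q : Set (Fin e → ℝ))
    (hP : LatticePolytope.IsZeroOnePolytope P)
    (hPdim : LatticePolytope.dim P = d)
    (hP0 : (0 : Fin d → ℝ) ∈ P)
    (hQ : LatticePolytope.IsIntegralPolytope Q)
    (hQdim : LatticePolytope.dim Q = e)
    (hQ0 : (0 : Fin e → ℝ) ∈ Q)
    (hPspan : LatticePolytope.SpansLattice P)
    (hQspan : LatticePolytope.SpansLattice Q) :
    LatticePolytope.HasIDP (LatticePolytope.freeSum P Q) ↔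
      (LatticePolytope.HasIDP P ∧ LatticePolytope.HasIDP Q) ∧
        (LatticePolytope.HasZeroOneFacetEquations P ∨
          LatticePolytope.HasZeroOneFacetEquations Q) := by
  have hPc : Convex ℝ P := by
    obtain ⟨S, -, hS⟩ := hP.1
    exact hS ▸ convex_convexHull ℝ S
  have hQc : Convex ℝ Q := by
    obtain ⟨S, -, hS⟩ := hQ.1
    exact hS ▸ convex_convexHull ℝ S
  have hPdim' : dim P = Fintype.card (Fin d) := by rw [hPdim, Fintype.card_fin]
  have hQdim' : dim Q = Fintype.card (Fin e) := by rw [hQdim, Fintype.card_fin]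
  constructor
  · intro h
    have hlat : ∀ z ∈ freeSum P Q ∩ integerPoints (Fin (d + e)),
        (fstProj d e z ∈ P ∧ sndProj d e z = 0) ∨ (fstProj d e z = 0 ∧ sndProj d e z ∈ Q) :=
      fun z hz => lattice_point_freeSum hP hPc hQc hP0 hQ0 hz.1 hz.2
    refine ⟨⟨hasIDP_fst_of_freeSum hQ0 (fun z hz => ?_) h,
      hasIDP_snd_of_freeSum hP0 (fun z hz => ?_) h⟩, ?_⟩
    · rcases hlat z hz with h | h
      · exact h.1
      · exact h.1 ▸ hP0
    · rcases hlat z hz with h | h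
      · exact h.2 ▸ hQ0
      · exact h.2
    · by_contra! hnot
      have hx := mt (hasZeroOneFacetEquations_of_round hP.isIntegralPolytope hPdim' hP0) hnot.1
      have hy := mt (hasZeroOneFacetEquations_of_round hQ hQdim' hQ0) hnot.2
      push Not at hx hy
      obtain ⟨x, hxi, m, hxm, hxm'⟩ := hx
      obtain ⟨y, hyi, m', hym, hym'⟩ := hy
      have hmem := append_mem_smul_freeSum (by positivity) (by positivity) hxm hym
      have hn : (m : ℝ) + 1 / 2 + (m' + 1 / 2) = ((m + m' + 1 : ℕ) : ℝ) := by
        push_cast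
        ring
      rw [hn] at hmem
      obtain ⟨k, k', hk, hxk, hyk⟩ := exists_nat_split_of_hasIDP hPc hQc hP0 hQ0 hlat h
        (append_mem_integerPoints hxi hyi) (by omega) hmem
      rw [fstProj_append] at hxk
      rw [sndProj_append] at hyk
      -- From `k + k' = m + m' + 1`, either `k ≤ m` or `k' ≤ m'`, and each contradicts the choice of
      -- a point.
      rcases le_or_gt k m with hkm | hkm
      · exact hxm' (smul_set_mono hPc hP0 k.cast_nonneg (Nat.cast_le.2 hkm) hxk)
      · exact hym' (smul_set_mono hQc hQ0 k'.cast_nonneg (Nat.cast_le.2 (by omega)) hyk)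
  · rintro ⟨⟨hPI, hQI⟩, hfac⟩
    refine hasIDP_freeSum hPI hQI fun γ hγi n hγ => ?_
    obtain ⟨r, s, hr, hs, hrs, hx, hy⟩ := exists_split hPc hQc hP0 hQ0 hγ
    rcases hfac with hfac | hfac
    · obtain ⟨m, hm, hym⟩ := exists_floor_split hQc hQ0 hr hs hrs hy
      exact ⟨_, m, hm, mem_floor_smul_set hP.1 hPdim' hP0 hfac (fstProj_mem_integerPoints hγi) hr hx,
        hym⟩
    · obtain ⟨m, hm, hxm⟩ := exists_floor_split hPc hP0 hs hr ((add_comm s r).trans hrs) hx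
      exact ⟨m, _, (add_comm _ _).trans hm, hxm,
        mem_floor_smul_set hQ.1 hQdim' hQ0 hfac (sndProj_mem_integerPoints hγi) hs hy⟩
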